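/- Let $B$ be a unital $C^*$-algebra, let $A\subseteq B$ be a (not necessarily selfadjoint) subalgebra containing $1_B$, and regard $A\subseteq B\subseteq B^{**}$, where the second dual $B^{**}$ is a $W^*$-algebra. For a subset $X\subseteq B$ write $\overline{X}^{w*}$ for its weak* closure in $B^{**}$, and extend functionals on $B$ to weak*-continuous functionals on $B^{**}$. We use the following terms. A projection $q\in B^{**}$ is \emph{closed} if $1-q$ is the weak* limit of an increasing net $(b_t)$ in $B$ with $0\le b_t\le 1$. It is a \emph{peak projection for $A$} if it is closed and there is $a\in A$ with $\|a\|\le 1$, $qa=q$, and $\varphi(a^*a)<1$ for every state $\varphi$ of $B$ with $\varphi(q)=0$. It is a \emph{$p$-projection for $A$} if it is the meet, in the lattice of projections of $B^{**}$, of a family of peak projections for $A$. A projection $p\in B^{**}$ is the \emph{support projection} of a right ideal $J$ of $A$ if $\overline{J}^{w*}=p\,\overline{A}^{w*}$. Let $J$ be a right ideal of $A$ that has a left approximate identity of the form $(1-x_t)_t$ with $x_t\in A$ and $\|x_t\|\le 1$; that is, $(x_t)_t$ is a net in $A$ with $\|x_t\|\le1$ and $1-x_t\in J$ for all $t$, and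 $(1-x_t)j\to j$ in norm for every $j\in J$. Let $p\in B^{**}$ be the support projection of $J$. Then $1-p$ is a $p$-projection for $A$. -/

import Mathlib

open Filter Topology

noncomputable section

namespace OperatorAlgebraPeak

universe u v

section SecondDual

variable (B : Type u) [CStarAlgebra B]

/-- The second dual `B**` of a C*-algebra `B`, carrying its weak* topology. -/
abbrev SecondDual : Type u := WeakDual ℂ (StrongDual ℂ B)

variable {B}

/-- The canonical embedding of `B` into `B**`: `(canon b)(φ) = φ(b)`. -/
def canon (b : B) : SecondDual B :=
  StrongDual.toWeakDual (NormedSpace.inclusionInDoubleDual ℂ B b)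

/-- For `G` in `B**`, the map `φ ↦ G · φ` on `B*`, where `(G · φ)(a) = G(b ↦ φ(a b))`. -/
def dualAction (G : StrongDual ℂ (StrongDual ℂ B)) : StrongDual ℂ B →L[ℂ] StrongDual ℂ B :=
  (ContinuousLinearMap.compL ℂ B (StrongDual ℂ B) ℂ G).comp
    (((ContinuousLinearMap.compL ℂ B (B →L[ℂ] B) (StrongDual ℂ B)).flip
        (ContinuousLinearMap.mul ℂ B)).comp
      (ContinuousLinearMap.compL ℂ B B ℂ))

/-- The (first) Arens product on `B**`: `(F G)(φ) = F(G · φ)`. For a C*-algebra the two Arens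
products coincide, and this is the product of the W*-algebra `B**`. -/
def mul (F G : SecondDual B) : SecondDual B :=
  StrongDual.toWeakDual
    ((WeakDual.toStrongDual F).comp (dualAction (WeakDual.toStrongDual G)))

/-- The conjugate-linear involution on `B*`: `φ^*(b) = conj (φ (b^*))`. -/
def dualStar : StrongDual ℂ B →L⋆[ℂ] StrongDual ℂ B :=
  LinearMap.mkContinuous
    { toFun := fun φ =>
        ((starL ℂ : ℂ ≃L⋆[ℂ] ℂ) : ℂ →L⋆[ℂ] ℂ).comp
          (φ.comp ((starL ℂ : B ≃L⋆[ℂ] B) : B →L⋆[ℂ] B))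
      map_add' := fun φ ψ => by ext b; simp
      map_smul' := fun c φ => by ext b; simp }
    1 (fun φ => by
      refine ContinuousLinearMap.opNorm_le_bound _ (by positivity) (fun b => ?_)
      simpa using φ.le_opNorm (star b))

/-- The involution of `B**`: `F^*(φ) = conj (F (φ^*))`. -/
def adj (F : SecondDual B) : SecondDual B :=
  StrongDual.toWeakDual
    (((starL ℂ : ℂ ≃L⋆[ℂ] ℂ) : ℂ →L⋆[ℂ] ℂ).comp ((WeakDual.toStrongDual F).comp dualStar))

/-- Orthogonal projections in `B**`: self-adjoint idempotents. -/
def IsProjection (p : SecondDual B) : Prop :=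
  adj p = p ∧ mul p p = p

/-- The complement `1 - p` in `B**`. -/
def compl (p : SecondDual B) : SecondDual B := canon 1 - p

/-- The order `q ≤ r` between projections of `B**`, i.e. `q r = q`. -/
def ProjLE (q r : SecondDual B) : Prop := mul q r = q

/-- `q` is the meet `⋀ S` of the set `S` of projections in the lattice of projections of `B**`. -/
def IsMeet (S : Set (SecondDual B)) (q : SecondDual B) : Prop :=
  IsProjection q ∧ (∀ r ∈ S, ProjLE q r) ∧
    ∀ q', IsProjection q' → (∀ r ∈ S, ProjLE q' r) → ProjLE q' q

/-- States of `B`: positive functionals of norm one. -/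
def IsState (φ : StrongDual ℂ B) : Prop :=
  ‖φ‖ = 1 ∧ ∀ b : B, ∃ r : ℝ, 0 ≤ r ∧ φ (star b * b) = (r : ℂ)

end SecondDual

section Projections

variable {B : Type u} [CStarAlgebra B] [PartialOrder B] [StarOrderedRing B]

/-- Open projections: weak* limits of increasing nets `(b_t)` in `B` with `0 ≤ b_t ≤ 1`. -/
def IsOpenProjection (p : SecondDual B) : Prop :=
  IsProjection p ∧
    ∃ (T : Type u) (_ : Preorder T) (_ : IsDirectedOrder T) (_ : Nonempty T) (b : T → B),
      Monotone b ∧ (∀ t, 0 ≤ b t ∧ b t ≤ 1) ∧ Tendsto (fun t => canon (b t)) atTop (𝓝 p)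

/-- Closed projections: complements of open projections. -/
def IsClosedProjection (q : SecondDual B) : Prop :=
  IsProjection q ∧ IsOpenProjection (compl q)

/-- `q` is a peak projection for `A`: it is a closed projection, and there is a contraction `a` in
`A` with `q a = q` and `φ(a^* a) < 1` for all states `φ` of `B` with `φ(q) = 0`. -/
def IsPeakProjection (A : Subalgebra ℂ B) (q : SecondDual B) : Prop :=
  IsClosedProjection q ∧
    ∃ a ∈ A, ‖a‖ ≤ 1 ∧ mul q (canon a) = q ∧
      ∀ φ : StrongDual ℂ B, IsState φ → q φ = 0 → (φ (star a * a)).re < 1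

/-- `q` is a `p`-projection for `A`: a meet of peak projections for `A`. -/
def IsPProjection (A : Subalgebra ℂ B) (q : SecondDual B) : Prop :=
  ∃ S : Set (SecondDual B), (∀ r ∈ S, IsPeakProjection A r) ∧ IsMeet S q

end Projections

section Ideals

variable {B : Type u} [CStarAlgebra B]

/-- `J` is a right ideal of the subalgebra `A`. -/
def IsRightIdeal (A : Subalgebra ℂ B) (J : Submodule ℂ B) : Prop :=
  (∀ j ∈ J, j ∈ A) ∧ ∀ j ∈ J, ∀ a ∈ A, j * a ∈ J

/-- The net `e` is a left approximate identity of `J`. -/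
def IsLeftApproxIdentity {T : Type v} [Preorder T] (J : Submodule ℂ B) (e : T → B) : Prop :=
  (∀ t, e t ∈ J) ∧ ∀ j ∈ J, Tendsto (fun t => e t * j) atTop (𝓝 j)

/-- The weak* closure in `B**` of a subset of `B`; for a subspace `X` this is `X^{⊥⊥}`. -/
def weakStarClosure (X : Set B) : Set (SecondDual B) := closure (canon '' X)

/-- `p` is the support projection of the right ideal `J` of `A`: it is a projection of `B**`, and
the weak* closure of `J` is `p A^{⊥⊥}`. -/
def IsSupportProjection (A : Subalgebra ℂ B) (J : Submodule ℂ B) (p : SecondDual B) : Prop :=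
  IsProjection p ∧
    weakStarClosure (J : Set B) = (fun F => mul p F) '' weakStarClosure (A : Set B)

end Ideals

end OperatorAlgebraPeak

end

noncomputable section

namespace OperatorAlgebraPeak

section CStar

lemma norm_one_le_one {B : Type*} [CStarAlgebra B] : ‖(1 : B)‖ ≤ 1 := by
  rcases subsingleton_or_nontrivial B with h | h
  · simp [Subsingleton.elim (1 : B) 0]
  · exact (CStarRing.norm_one (E := B)).le

variable {B : Type*} [CStarAlgebra B] [PartialOrder B] [StarOrderedRing B]

/-- The Cauchy–Schwarz inequality for finite rows and columns over a C*-algebra. -/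
lemma norm_sum_mul_sq_le {ι : Type*} [Fintype ι] (a b : ι → B) :
    ‖∑ i, a i * b i‖ ^ 2 ≤ ‖∑ i, a i * star (a i)‖ * ‖∑ i, star (b i) * b i‖ := by
  let X : WithCStarModule B (ι → B) := (WithCStarModule.equiv B (ι → B)).symm fun i => star (b i)
  let Y : WithCStarModule B (ι → B) := (WithCStarModule.equiv B (ι → B)).symm a
  have h := CStarModule.norm_inner_le (A := B) (E := WithCStarModule B (ι → B)) (x := X) (y := Y)
  have hX : ‖X‖ = √‖∑ i, star (b i) * b i‖ := by
    rw [CStarModule.norm_eq_sqrt_norm_inner_self (A := B)]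
    simp [X, WithCStarModule.pi_inner, WithCStarModule.inner_def]
  have hY : ‖Y‖ = √‖∑ i, a i * star (a i)‖ := by
    rw [CStarModule.norm_eq_sqrt_norm_inner_self (A := B)]
    simp [Y, WithCStarModule.pi_inner, WithCStarModule.inner_def]
  have hXY : inner B X Y = ∑ i, a i * b i := by
    simp [X, Y, WithCStarModule.pi_inner, WithCStarModule.inner_def]
  rw [hX, hY, hXY] at h
  calc ‖∑ i, a i * b i‖ ^ 2
      ≤ (√‖∑ i, star (b i) * b i‖ * √‖∑ i, a i * star (a i)‖) ^ 2 := by gcongr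
    _ = _ := by
      rw [mul_pow, Real.sq_sqrt (norm_nonneg _), Real.sq_sqrt (norm_nonneg _), mul_comm]

/-- If the increments of a finite increasing chain in `[0, 1]` are multiplied by contractions,
their sum grows at most like the square root of the length of the chain. -/
lemma norm_sum_mul_sub_sq_le {g : ℕ → B} (hg : Monotone g) (h01 : ∀ k, 0 ≤ g k ∧ g k ≤ 1)
    {a : ℕ → B} (ha : ∀ k, ‖a k‖ ≤ 1) (K : ℕ) :
    ‖∑ i : Fin K, a i * (g (i + 1) - g i)‖ ^ 2 ≤ K := by
  refine (norm_sum_mul_sq_le _ _).trans ?_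
  have h1 : ‖∑ i : Fin K, a i * star (a i)‖ ≤ K := by
    refine (norm_sum_le _ _).trans ?_
    calc ∑ i : Fin K, ‖a i * star (a i)‖ ≤ ∑ i : Fin K, (1 : ℝ) := by
          refine Finset.sum_le_sum fun i _ => ?_
          rw [CStarRing.norm_self_mul_star]
          exact mul_le_one₀ (ha i) (norm_nonneg _) (ha i)
      _ = K := by simp
  have hpos : ∀ i, 0 ≤ g (i + 1) - g i := fun i => sub_nonneg.2 (hg (Nat.le_succ i))
  have hle : ∀ i, g (i + 1) - g i ≤ 1 := fun i =>
    (sub_le_self _ (h01 i).1).trans (h01 (i + 1)).2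
  have hsq : ∀ i, star (g (i + 1) - g i) * (g (i + 1) - g i) ≤ g (i + 1) - g i := fun i => by
    have := CStarAlgebra.pow_antitone (hpos i) (hle i) (show 1 ≤ 2 by norm_num)
    simpa [pow_two, (IsSelfAdjoint.of_nonneg (hpos i)).star_eq] using this
  have h2 : ‖∑ i : Fin K, star (g (i + 1) - g i) * (g (i + 1) - g i)‖ ≤ 1 := by
    refine (CStarAlgebra.norm_le_norm_of_nonneg_of_le (b := (1 : B))
      (Finset.sum_nonneg fun i _ => star_mul_self_nonneg _) ?_).trans norm_one_le_one
    calc ∑ i : Fin K, star (g (i + 1) - g i) * (g (i + 1) - g i)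
        ≤ ∑ i : Fin K, (g (i + 1) - g i) := Finset.sum_le_sum fun i _ => hsq i
      _ = g K - g 0 := by
        rw [Fin.sum_univ_eq_sum_range fun i => g (i + 1) - g i, Finset.sum_range_sub]
      _ ≤ 1 := (sub_le_self _ (h01 0).1).trans (h01 K).2
  calc _ ≤ (K : ℝ) * 1 := by gcongr
    _ = K := mul_one _

/-- The operator monotone function `s ↦ s / (1 + s)` of a positive element. -/
def softUnit (k : B) : B := 1 - Ring.inverse (1 + k)

lemma isStrictlyPositive_one_add {k : B} (hk : 0 ≤ k) : IsStrictlyPositive (1 + k) :=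
  isStrictlyPositive_one.add_nonneg hk

lemma one_add_mul_inverse {k : B} (hk : 0 ≤ k) : (1 + k) * Ring.inverse (1 + k) = 1 :=
  Ring.mul_inverse_cancel _ (isStrictlyPositive_one_add hk).isUnit

lemma inverse_mul_one_add {k : B} (hk : 0 ≤ k) : Ring.inverse (1 + k) * (1 + k) = 1 :=
  Ring.inverse_mul_cancel _ (isStrictlyPositive_one_add hk).isUnit

lemma star_inverse_one_add {k : B} (hk : 0 ≤ k) :
    star (Ring.inverse (1 + k)) = Ring.inverse (1 + k) := by
  rw [← Ring.inverse_star]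
  simp [(IsSelfAdjoint.of_nonneg hk).star_eq]

lemma inverse_one_add_nonneg {k : B} (hk : 0 ≤ k) : 0 ≤ Ring.inverse (1 + k) := by
  have h := star_left_conjugate_nonneg (isStrictlyPositive_one_add hk).nonneg (Ring.inverse (1 + k))
  rwa [star_inverse_one_add hk, inverse_mul_one_add hk, one_mul] at h

lemma inverse_one_add_le_one {k : B} (hk : 0 ≤ k) : Ring.inverse (1 + k) ≤ 1 := by
  have := CStarAlgebra.ringInverse_le_ringInverse (a := (1 : B)) (b := 1 + k)
    (le_add_of_nonneg_right hk) isStrictlyPositive_one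
  simpa using this

lemma softUnit_nonneg {k : B} (hk : 0 ≤ k) : 0 ≤ softUnit k :=
  sub_nonneg.2 (inverse_one_add_le_one hk)

lemma softUnit_le_one {k : B} (hk : 0 ≤ k) : softUnit k ≤ 1 :=
  sub_le_self _ (inverse_one_add_nonneg hk)

lemma softUnit_mono {k l : B} (hk : 0 ≤ k) (hkl : k ≤ l) : softUnit k ≤ softUnit l :=
  sub_le_sub_left (CStarAlgebra.ringInverse_le_ringInverse (add_le_add_right hkl 1)
    (isStrictlyPositive_one_add hk)) _

lemma softUnit_eq_mul_inverse {k : B} (hk : 0 ≤ k) :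
    softUnit k = k * Ring.inverse (1 + k) := by
  have := one_add_mul_inverse hk
  rw [add_mul, one_mul] at this
  rw [softUnit, sub_eq_iff_eq_add']
  exact this.symm

lemma softUnit_le_self {k : B} (hk : 0 ≤ k) : softUnit k ≤ k := by
  have h1 : k - softUnit k = k * Ring.inverse (1 + k) * k := by
    rw [softUnit_eq_mul_inverse hk, mul_assoc, ← mul_one k, mul_assoc, one_mul, ← mul_sub]
    have := inverse_mul_one_add hk
    rw [mul_add, mul_one] at this
    rw [mul_one, ← eq_sub_iff_add_eq'.2 this]
  rw [← sub_nonneg, h1]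
  have := star_left_conjugate_nonneg (inverse_one_add_nonneg hk) k
  rwa [(IsSelfAdjoint.of_nonneg hk).star_eq] at this

lemma conjugate_one_sub_softUnit_le_one {k : B} (hk : 0 ≤ k) :
    (1 - softUnit k) * k * (1 - softUnit k) ≤ 1 := by
  set c := Ring.inverse (1 + k) with hc
  have h : (1 - softUnit k) * k * (1 - softUnit k) = c - c * c := by
    rw [softUnit, sub_sub_cancel, ← hc, mul_assoc, ← softUnit_eq_mul_inverse hk, softUnit, ← hc,
      mul_sub, mul_one]
  rw [h]
  refine (sub_le_self _ ?_).trans (inverse_one_add_le_one hk)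
  simpa [hc, star_inverse_one_add hk] using star_mul_self_nonneg c

/-- `s / (1 + s)` at `s = n k` is almost a left unit for every `d` with `d d* ≤ k`. -/
lemma norm_one_sub_softUnit_mul_sq_le {k d : B} (hd : d * star d ≤ k) {n : ℕ} (hn : 0 < n) :
    ‖(1 - softUnit ((n : ℝ) • k)) * d‖ ^ 2 ≤ (n : ℝ)⁻¹ := by
  have hk : 0 ≤ k := (mul_star_self_nonneg d).trans hd
  have hnk : 0 ≤ (n : ℝ) • k := smul_nonneg (Nat.cast_nonneg n) hk
  have hn' : (0 : ℝ) < n := by exact_mod_cast hn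
  set c := 1 - softUnit ((n : ℝ) • k) with hc
  have hcs : star c = c := by
    rw [hc, softUnit, sub_sub_cancel, star_inverse_one_add hnk]
  have h1 : ‖c * d‖ ^ 2 = ‖c * (d * star d) * c‖ := by
    rw [pow_two, ← CStarRing.norm_self_mul_star, star_mul, hcs]
    simp only [mul_assoc]
  have h2 : c * (d * star d) * c ≤ (n : ℝ)⁻¹ • (1 : B) := by
    calc c * (d * star d) * c ≤ c * k * c := by
          simpa [hcs] using star_left_conjugate_le_conjugate hd c
      _ = (n : ℝ)⁻¹ • (c * ((n : ℝ) • k) * c) := by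
          rw [mul_smul_comm, smul_mul_assoc, smul_smul, inv_mul_cancel₀ hn'.ne', one_smul]
      _ ≤ (n : ℝ)⁻¹ • (1 : B) :=
          smul_le_smul_of_nonneg_left (conjugate_one_sub_softUnit_le_one hnk) (by positivity)
  rw [h1]
  refine (CStarAlgebra.norm_le_norm_of_nonneg_of_le ?_ h2).trans ?_
  · simpa [hcs] using star_left_conjugate_nonneg (mul_star_self_nonneg d) c
  · rw [norm_smul, norm_inv, Real.norm_natCast]
    exact mul_le_of_le_one_right (by positivity) norm_one_le_one

end CStar

section Arens

variable {B : Type*} [CStarAlgebra B]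

@[simp] lemma canon_apply (b : B) (φ : StrongDual ℂ B) : canon b φ = φ b := rfl

lemma dualAction_apply (G : StrongDual ℂ (StrongDual ℂ B)) (φ : StrongDual ℂ B) (a : B) :
    dualAction G φ a = G (φ.comp (ContinuousLinearMap.mul ℂ B a)) := rfl

lemma mul_apply (F G : SecondDual B) (φ : StrongDual ℂ B) :
    mul F G φ = F (dualAction (WeakDual.toStrongDual G) φ) := rfl

@[simp] lemma dualAction_canon_apply (b : B) (φ : StrongDual ℂ B) (a : B) :
    dualAction (WeakDual.toStrongDual (canon b)) φ a = φ (a * b) := rfl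

lemma dualStar_apply (φ : StrongDual ℂ B) (b : B) : dualStar φ b = star (φ (star b)) := rfl

lemma adj_apply (F : SecondDual B) (φ : StrongDual ℂ B) : adj F φ = star (F (dualStar φ)) := rfl

lemma dualStar_dualStar (φ : StrongDual ℂ B) : dualStar (dualStar φ) = φ := by
  ext b; simp [dualStar_apply]

lemma secondDual_ext {F G : SecondDual B} (h : ∀ φ, F φ = G φ) : F = G := DFunLike.ext _ _ h

@[simp] lemma secondDual_sub_apply (F G : SecondDual B) (φ : StrongDual ℂ B) :
    (F - G) φ = F φ - G φ := rfl

lemma adj_adj (F : SecondDual B) : adj (adj F) = F :=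
  secondDual_ext fun φ => by simp [adj_apply, dualStar_dualStar]

lemma adj_canon (b : B) : adj (canon b) = canon (star b) :=
  secondDual_ext fun φ => by simp [adj_apply, dualStar_apply]

lemma adj_sub (F G : SecondDual B) : adj (F - G) = adj F - adj G :=
  secondDual_ext fun φ => by simp [adj_apply]

lemma mul_assoc' (F G H : SecondDual B) : mul (mul F G) H = mul F (mul G H) :=
  secondDual_ext fun φ => by
    simp only [mul_apply]
    congr 1
    ext a
    rw [dualAction_apply, dualAction_apply]
    change _ = G (dualAction (WeakDual.toStrongDual H) _)
    refine congrArg G ?_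
    ext b
    change WeakDual.toStrongDual H _ = WeakDual.toStrongDual H _
    congr 1
    ext c
    simp [mul_assoc]

lemma mul_sub' (F G H : SecondDual B) : mul F (G - H) = mul F G - mul F H :=
  secondDual_ext fun φ => by
    simp only [mul_apply, secondDual_sub_apply]
    rw [← map_sub]
    congr 1

lemma sub_mul' (F G H : SecondDual B) : mul (F - G) H = mul F H - mul G H := rfl

lemma zero_mul' (F : SecondDual B) : mul 0 F = 0 := rfl

lemma mul_canon_one (F : SecondDual B) : mul F (canon 1) = F :=
  secondDual_ext fun φ => by
    rw [mul_apply]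
    congr 1
    ext a
    simp

lemma canon_one_mul (F : SecondDual B) : mul (canon 1) F = F :=
  secondDual_ext fun φ => by
    rw [mul_apply, canon_apply, dualAction_apply]
    congr 1
    ext a
    simp

lemma mul_canon_canon (a b : B) : mul (canon a) (canon b) = canon (a * b) := rfl

lemma mul_canon_mul (F : SecondDual B) (a b : B) :
    mul F (canon (a * b)) = mul (mul F (canon a)) (canon b) := by
  rw [mul_assoc', mul_canon_canon]

/-- For fixed `F` in `B**`, the map `b ↦ F b` on `B` is linear. -/
def mulCanon (F : SecondDual B) : B →ₗ[ℂ] SecondDual B where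
  toFun b := mul F (canon b)
  map_add' a b := secondDual_ext fun φ => by
    change F _ = F _ + F _
    rw [← map_add]
    congr 1
    ext c
    simp [mul_add]
  map_smul' z a := secondDual_ext fun φ => by
    change F _ = z • F _
    rw [← map_smul]
    congr 1
    ext c
    simp

lemma mulCanon_apply (F : SecondDual B) (b : B) : mulCanon F b = mul F (canon b) := rfl

lemma mul_smul_canon_eq_zero {F : SecondDual B} {b : B} (h : mul F (canon b) = 0) (r : ℝ) :
    mul F (canon (r • b)) = 0 := by
  rw [← mulCanon_apply, ← Complex.coe_smul, map_smul, mulCanon_apply, h, smul_zero]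

lemma continuous_mul_canon_apply (F : SecondDual B) (φ : StrongDual ℂ B) :
    Continuous fun b : B => mul F (canon b) φ :=
  (WeakDual.toStrongDual F).continuous.comp
    ((((ContinuousLinearMap.compL ℂ B B ℂ φ).comp (ContinuousLinearMap.mul ℂ B).flip)).continuous)

lemma continuous_mul_left (G : SecondDual B) : Continuous fun F : SecondDual B => mul F G :=
  WeakDual.continuous_of_continuous_eval fun φ =>
    WeakDual.eval_continuous (dualAction (WeakDual.toStrongDual G) φ)

lemma continuous_adj : Continuous (adj : SecondDual B → SecondDual B) :=
  WeakDual.continuous_of_continuous_eval fun φ =>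
    continuous_star.comp (WeakDual.eval_continuous (dualStar φ))

lemma adj_mul_canon (F : SecondDual B) (b : B) :
    adj (mul F (canon b)) = mul (canon (star b)) (adj F) :=
  secondDual_ext fun φ => by
    rw [adj_apply, mul_apply, mul_apply, canon_apply, dualAction_apply]
    change _ = star (F _)
    congr 2
    ext a
    simp [dualStar_apply]

lemma compl_compl (p : SecondDual B) : compl (compl p) = p := sub_sub_cancel _ _

lemma mul_compl (F p : SecondDual B) : mul F (compl p) = F - mul F p := by
  rw [compl, mul_sub', mul_canon_one]

lemma compl_mul (F p : SecondDual B) : mul (compl p) F = F - mul p F := by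
  rw [compl, sub_mul', canon_one_mul]

lemma IsProjection.compl {p : SecondDual B} (hp : IsProjection p) :
    IsProjection (OperatorAlgebraPeak.compl p) := by
  refine ⟨?_, ?_⟩
  · rw [OperatorAlgebraPeak.compl, adj_sub, adj_canon, star_one, hp.1]
  · rw [mul_compl, compl_mul, hp.2, sub_self]
    exact secondDual_ext fun φ => sub_zero _

end Arens

section Nets

lemma exists_norm_le_one_lt_re {B : Type*} [CStarAlgebra B] (ψ : StrongDual ℂ B) {ε : ℝ} (hε : 0 ≤ ε) (h : ε < ‖ψ‖) :
    ∃ a : B, ‖a‖ ≤ 1 ∧ ε ≤ (ψ a).re := by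
  obtain ⟨a, ha⟩ : ∃ a, ε * ‖a‖ < ‖ψ a‖ := by
    by_contra! hcon
    exact absurd (ψ.opNorm_le_bound hε hcon) (not_le.2 h)
  have hψa : 0 < ‖ψ a‖ := (mul_nonneg hε (norm_nonneg _)).trans_lt ha
  have ha0 : 0 < ‖a‖ := by
    rw [norm_pos_iff]
    rintro rfl
    simp at hψa
  refine ⟨((‖ψ a‖ * ‖a‖ : ℝ) : ℂ)⁻¹ • (starRingEnd ℂ (ψ a)) • a, ?_, ?_⟩
  · rw [norm_smul, norm_smul, norm_inv, Complex.norm_real, RCLike.norm_conj, norm_mul, norm_norm,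
      norm_norm, inv_mul_cancel₀ (by positivity)]
  · have : ψ (((‖ψ a‖ * ‖a‖ : ℝ) : ℂ)⁻¹ • (starRingEnd ℂ (ψ a)) • a) = ((‖ψ a‖ / ‖a‖ : ℝ) : ℂ) := by
      rw [map_smul, map_smul, smul_eq_mul, smul_eq_mul, ← Complex.normSq_eq_conj_mul_self,
        Complex.normSq_eq_norm_sq, ← Complex.ofReal_inv, ← Complex.ofReal_mul]
      congr 1
      field_simp
    rw [this, Complex.ofReal_re, le_div_iff₀ ha0]
    exact ha.le

variable {B : Type*} [CStarAlgebra B] [PartialOrder B] [StarOrderedRing B]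

/-- Along an increasing net `g` in `[0, 1]`, the functionals `g_l · φ` form a norm Cauchy net. -/
lemma cauchySeq_dualAction {Λ : Type*} [Nonempty Λ] [SemilatticeSup Λ] {g : Λ → B}
    (hg : Monotone g) (h01 : ∀ l, 0 ≤ g l ∧ g l ≤ 1) (φ : StrongDual ℂ B) :
    CauchySeq fun l => dualAction (WeakDual.toStrongDual (canon (g l))) φ := by
  rw [Metric.cauchySeq_iff']
  by_contra! hcon
  obtain ⟨ε, hε, hcon⟩ := hcon
  choose s hs hsε using hcon
  let N : ℕ → Λ := fun k => s^[k] (Classical.arbitrary Λ)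
  have hN : ∀ k, N (k + 1) = s (N k) := fun k => Function.iterate_succ_apply' s k _
  have hmono : Monotone N := monotone_nat_of_le_succ fun k => (hN k).symm ▸ hs (N k)
  have key : ∀ k, ∃ a : B, ‖a‖ ≤ 1 ∧ ε / 2 ≤ (φ (a * (g (N (k + 1)) - g (N k)))).re := by
    intro k
    have h := hsε (N k)
    rw [← hN, dist_eq_norm] at h
    obtain ⟨a, ha, ha'⟩ := exists_norm_le_one_lt_re _ (half_pos hε).le ((half_lt_self hε).trans_le h)
    refine ⟨a, ha, ?_⟩
    simpa [mul_sub] using ha'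
  choose a ha ha' using key
  have hbound : ∀ K : ℕ, (K * (ε / 2)) ^ 2 ≤ ‖φ‖ ^ 2 * K := by
    intro K
    have h1 : K * (ε / 2) ≤ ‖φ‖ * ‖∑ i : Fin K, a i * (g (N (i + 1)) - g (N i))‖ := by
      calc K * (ε / 2) = ∑ i : Fin K, ε / 2 := by simp
        _ ≤ ∑ i : Fin K, (φ (a i * (g (N (i + 1)) - g (N i)))).re :=
          Finset.sum_le_sum fun i _ => ha' i
        _ = (φ (∑ i : Fin K, a i * (g (N (i + 1)) - g (N i)))).re := by
          rw [map_sum, Complex.re_sum]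
        _ ≤ ‖φ (∑ i : Fin K, a i * (g (N (i + 1)) - g (N i)))‖ := Complex.re_le_norm _
        _ ≤ _ := φ.le_opNorm _
    calc (K * (ε / 2)) ^ 2
        ≤ (‖φ‖ * ‖∑ i : Fin K, a i * (g (N (i + 1)) - g (N i))‖) ^ 2 := by gcongr
      _ = ‖φ‖ ^ 2 * ‖∑ i : Fin K, a i * (g (N (i + 1)) - g (N i))‖ ^ 2 := mul_pow _ _ _
      _ ≤ ‖φ‖ ^ 2 * K := by
        gcongr
        exact norm_sum_mul_sub_sq_le (hg.comp hmono) (fun k => h01 (N k)) ha K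
  obtain ⟨K, hK⟩ := exists_nat_gt (‖φ‖ ^ 2 / (ε / 2) ^ 2)
  have hK0 : (0 : ℝ) < K := lt_of_le_of_lt (by positivity) hK
  rw [div_lt_iff₀ (by positivity)] at hK
  have := hbound K
  nlinarith

/-- An increasing net `g` in `[0, 1]` has a weak* limit `P` in `B**`, and `g_l · φ → P · φ` in norm
for every `φ`. -/
lemma exists_tendsto_dualAction {Λ : Type*} [Nonempty Λ] [SemilatticeSup Λ] {g : Λ → B}
    (hg : Monotone g) (h01 : ∀ l, 0 ≤ g l ∧ g l ≤ 1) :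
    ∃ P : SecondDual B, Tendsto (fun l => canon (g l)) atTop (𝓝 P) ∧
      ∀ φ, Tendsto (fun l => dualAction (WeakDual.toStrongDual (canon (g l))) φ) atTop
        (𝓝 (dualAction (WeakDual.toStrongDual P) φ)) := by
  choose L hL using fun φ => cauchySeq_tendsto_of_complete (cauchySeq_dualAction hg h01 φ)
  have hL' : ∀ φ a, Tendsto (fun l => φ (a * g l)) atTop (𝓝 (L φ a)) := fun φ a =>
    ((ContinuousLinearMap.apply ℂ ℂ a).continuous.tendsto _).comp (hL φ)
  have hlim : Tendsto (fun l φ => WeakDual.toStrongDual (canon (g l)) φ) atTop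
      (𝓝 fun φ => L φ 1) := by
    rw [tendsto_pi_nhds]
    intro φ
    simpa using hL' φ 1
  let P : StrongDual ℂ (StrongDual ℂ B) :=
    (linearMapOfTendsto (fun φ => L φ 1)
      (fun l => (WeakDual.toStrongDual (canon (g l))).toLinearMap) hlim).mkContinuous 1 fun φ => by
        refine le_of_tendsto ((hL' φ 1).norm) (Eventually.of_forall fun l => ?_)
        rw [one_mul, one_mul]
        refine (φ.le_opNorm _).trans (mul_le_of_le_one_right (norm_nonneg _) ?_)
        exact (CStarAlgebra.norm_le_one_iff_of_nonneg _ (h01 l).1).2 (h01 l).2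
  have hP : Tendsto (fun l => canon (g l)) atTop (𝓝 (StrongDual.toWeakDual P)) := by
    refine (tendsto_iff_forall_eval_tendsto_topDualPairing).2 fun φ => ?_
    have h := hL' φ 1
    simp only [one_mul] at h
    exact h
  refine ⟨StrongDual.toWeakDual P, hP, fun φ => ?_⟩
  suffices h : dualAction P φ = L φ from h ▸ hL φ
  ext a
  refine tendsto_nhds_unique ?_ (hL' φ a)
  exact hL' (φ.comp (ContinuousLinearMap.mul ℂ B a)) 1 |>.congr fun l => by simp

end Nets

section Range

variable {B : Type*} [CStarAlgebra B] [PartialOrder B] [StarOrderedRing B]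

/-- The increasing net `n h_F (1 + n h_F)⁻¹`, where `h_F = ∑_{i ∈ F} d_i d_i^*`, whose weak* limit is
the projection onto the closed right ideal generated by the `d_i`. -/
def rangeNet {ι : Type*} (d : ι → B) (l : Finset ι × ℕ) : B :=
  softUnit ((l.2 : ℝ) • ∑ i ∈ l.1, d i * star (d i))

variable {ι : Type*} (d : ι → B)

lemma smul_sum_mul_star_nonneg (l : Finset ι × ℕ) :
    0 ≤ (l.2 : ℝ) • ∑ i ∈ l.1, d i * star (d i) :=
  smul_nonneg (Nat.cast_nonneg _) (Finset.sum_nonneg fun _ _ => mul_star_self_nonneg _)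

lemma rangeNet_mem (l : Finset ι × ℕ) : 0 ≤ rangeNet d l ∧ rangeNet d l ≤ 1 :=
  ⟨softUnit_nonneg (smul_sum_mul_star_nonneg d l), softUnit_le_one (smul_sum_mul_star_nonneg d l)⟩

lemma rangeNet_mono : Monotone (rangeNet d) := by
  intro l m hlm
  refine softUnit_mono (smul_sum_mul_star_nonneg d l) ?_
  calc (l.2 : ℝ) • ∑ i ∈ l.1, d i * star (d i)
      ≤ (l.2 : ℝ) • ∑ i ∈ m.1, d i * star (d i) :=
        smul_le_smul_of_nonneg_left
          (Finset.sum_le_sum_of_subset_of_nonneg hlm.1 fun _ _ _ => mul_star_self_nonneg _)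
          (Nat.cast_nonneg _)
    _ ≤ (m.2 : ℝ) • ∑ i ∈ m.1, d i * star (d i) :=
        smul_le_smul_of_nonneg_right (Nat.cast_le.2 hlm.2)
          (Finset.sum_nonneg fun _ _ => mul_star_self_nonneg _)

lemma tendsto_rangeNet_mul (i : ι) :
    Tendsto (fun l => rangeNet d l * d i) atTop (𝓝 (d i)) := by
  rw [tendsto_iff_norm_sub_tendsto_zero]
  have hsnd : Tendsto (fun l : Finset ι × ℕ => √((l.2 : ℝ)⁻¹)) atTop (𝓝 0) := by
    rw [← Real.sqrt_zero, ← prod_atTop_atTop_eq]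
    exact (Real.continuous_sqrt.tendsto 0).comp
      (tendsto_inv_atTop_nhds_zero_nat.comp tendsto_snd)
  refine squeeze_zero' (Eventually.of_forall fun _ => norm_nonneg _) ?_ hsnd
  filter_upwards [eventually_ge_atTop (({i}, 1) : Finset ι × ℕ)] with l hl
  have hle : d i * star (d i) ≤ ∑ j ∈ l.1, d j * star (d j) :=
    Finset.single_le_sum (f := fun j => d j * star (d j)) (fun j _ => mul_star_self_nonneg _)
      (Finset.singleton_subset_iff.1 hl.1)
  refine Real.le_sqrt_of_sq_le ?_
  rw [norm_sub_rev]
  simpa [rangeNet, sub_mul] using norm_one_sub_softUnit_mul_sq_le hle (n := l.2) hl.2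

lemma mul_rangeNet_eq_zero {F : SecondDual B} (hF : ∀ i, mul F (canon (d i)) = 0)
    (l : Finset ι × ℕ) : mul F (canon (rangeNet d l)) = 0 := by
  have h : mul F (canon (∑ i ∈ l.1, d i * star (d i))) = 0 := by
    rw [← mulCanon_apply, map_sum]
    refine Finset.sum_eq_zero fun i _ => ?_
    rw [mulCanon_apply, mul_canon_mul, hF, zero_mul']
  rw [rangeNet, softUnit_eq_mul_inverse (smul_sum_mul_star_nonneg d l), mul_canon_mul,
    mul_smul_canon_eq_zero h, zero_mul']

/-- The range projection of a family of elements of `B`, as an element of `B**`. -/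
lemma exists_rangeProjection :
    ∃ P : SecondDual B, IsProjection P ∧
      Tendsto (fun l => canon (rangeNet d l)) atTop (𝓝 P) ∧
      (∀ i, mul P (canon (d i)) = canon (d i)) ∧
      (∀ F : SecondDual B, (∀ i, mul F (canon (d i)) = 0) → mul F P = 0) ∧
      ∀ F : SecondDual B, adj (mul F P) = mul P (adj F) := by
  classical
  obtain ⟨P, hP, hPφ⟩ := exists_tendsto_dualAction (rangeNet_mono d) (rangeNet_mem d)
  have hmul : ∀ F : SecondDual B,
      Tendsto (fun l => mul F (canon (rangeNet d l))) atTop (𝓝 (mul F P)) := fun F =>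
    (tendsto_iff_forall_eval_tendsto_topDualPairing).2 fun φ =>
      ((WeakDual.toStrongDual F).continuous.tendsto _).comp (hPφ φ)
  have hunit : ∀ i, mul P (canon (d i)) = canon (d i) := by
    intro i
    refine tendsto_nhds_unique (((continuous_mul_left (canon (d i))).tendsto P).comp hP) ?_
    refine (tendsto_iff_forall_eval_tendsto_topDualPairing).2 fun φ => ?_
    exact (φ.continuous.tendsto _).comp (tendsto_rangeNet_mul d i)
  have hzero : ∀ F : SecondDual B, (∀ i, mul F (canon (d i)) = 0) → mul F P = 0 := by
    intro F hF
    refine tendsto_nhds_unique (hmul F) ?_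
    simp only [mul_rangeNet_eq_zero d hF]
    exact tendsto_const_nhds
  have hstar : ∀ l, star (rangeNet d l) = rangeNet d l := fun l =>
    (IsSelfAdjoint.of_nonneg (rangeNet_mem d l).1).star_eq
  refine ⟨P, ⟨?_, ?_⟩, hP, hunit, hzero, ?_⟩
  · refine tendsto_nhds_unique ((continuous_adj.tendsto P).comp hP) ?_
    simpa only [Function.comp_def, adj_canon, hstar] using hP
  · have h := hzero (compl P) fun i => by rw [compl_mul, hunit, sub_self]
    rw [compl_mul] at h
    exact (sub_eq_zero.1 h).symm
  · intro F
    refine tendsto_nhds_unique ((continuous_adj.tendsto _).comp (hmul F)) ?_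
    simp only [Function.comp_def, adj_mul_canon, hstar]
    exact ((continuous_mul_left (adj F)).tendsto P).comp hP

end Range

section Peak

lemma IsState.re_nonneg {B : Type*} [CStarAlgebra B] [PartialOrder B] [StarOrderedRing B]
    {φ : StrongDual ℂ B} (hφ : IsState φ) {b : B} (hb : 0 ≤ b) :
    0 ≤ (φ b).re ∧ (φ b).im = 0 := by
  obtain ⟨c, rfl⟩ := CStarAlgebra.nonneg_iff_eq_star_mul_self.1 hb
  obtain ⟨r, hr, h⟩ := hφ.2 c
  simp [h, hr]

lemma IsState.re_le {B : Type*} [CStarAlgebra B] {φ : StrongDual ℂ B} (hφ : IsState φ) {b : B}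
    (hb : ‖b‖ ≤ 1) : (φ b).re ≤ 1 := by
  refine (Complex.re_le_norm _).trans ((φ.le_opNorm b).trans ?_)
  rwa [hφ.1, one_mul]

/-- A state `φ` with `φ(a^* a) = 1`, where `a = (1 + x) / 2` for a contraction `x`, is concentrated
where `x` acts as the identity. -/
lemma IsState.apply_one_sub_mul_star {B : Type*} [CStarAlgebra B] [PartialOrder B]
    [StarOrderedRing B] {φ : StrongDual ℂ B} (hφ : IsState φ) {x : B} (hx : ‖x‖ ≤ 1)
    (h : 1 ≤ (φ (star ((2⁻¹ : ℂ) • (1 + x)) * ((2⁻¹ : ℂ) • (1 + x)))).re) :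
    (φ 1).re = 1 ∧ φ ((1 - x) * star (1 - x)) = 0 := by
  have h1 := hφ.re_le (norm_one_le_one (B := B))
  have h2 := hφ.re_le hx
  have h3 := hφ.re_le (b := star x) (by rwa [norm_star])
  have h4 := hφ.re_le (b := star x * x) (by
    rw [CStarRing.norm_star_mul_self]; exact mul_le_one₀ hx (norm_nonneg _) hx)
  have h5 := hφ.re_le (b := x * star x) (by
    rw [CStarRing.norm_self_mul_star]; exact mul_le_one₀ hx (norm_nonneg _) hx)
  have e : star ((2⁻¹ : ℂ) • (1 + x)) * ((2⁻¹ : ℂ) • (1 + x)) =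
      ((4⁻¹ : ℝ) : ℂ) • (1 + x + star x + star x * x) := by
    rw [star_smul, smul_mul_smul_comm, star_add, star_one, add_mul, mul_add, mul_add]
    congr 1
    · simp; norm_num
    · simp; abel
  rw [e, map_smul, smul_eq_mul, Complex.re_ofReal_mul] at h
  simp only [map_add, Complex.add_re] at h
  have e' : (1 - x) * star (1 - x) = 1 - x - star x + x * star x := by
    rw [star_sub, star_one, sub_mul, mul_sub, mul_sub]
    simp; abel
  have hpos := hφ.re_nonneg (mul_star_self_nonneg (1 - x))
  refine ⟨by linarith, Complex.ext ?_ hpos.2⟩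
  refine le_antisymm ?_ hpos.1
  rw [e']
  simp only [map_add, map_sub, Complex.add_re, Complex.sub_re, Complex.zero_re]
  linarith

lemma IsState.rangeNet_eq_zero {B : Type*} [CStarAlgebra B] [PartialOrder B] [StarOrderedRing B]
    {φ : StrongDual ℂ B} (hφ : IsState φ) {ι : Type*} {d : ι → B}
    (h : ∀ i, φ (d i * star (d i)) = 0) (l : Finset ι × ℕ) : φ (rangeNet d l) = 0 := by
  have h0 := hφ.re_nonneg (rangeNet_mem d l).1
  have h1 := hφ.re_nonneg (sub_nonneg.2 (softUnit_le_self (smul_sum_mul_star_nonneg d l)))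
  have h2 : φ ((l.2 : ℝ) • ∑ i ∈ l.1, d i * star (d i)) = 0 := by
    rw [← Complex.coe_smul, map_smul, map_sum, Finset.sum_eq_zero fun i _ => h i, smul_zero]
  rw [map_sub, h2, zero_sub, Complex.neg_re] at h1
  exact Complex.ext (le_antisymm (by simpa [rangeNet] using h1.1) h0.1) h0.2

end Peak

section Main

variable {B : Type*} [CStarAlgebra B] [PartialOrder B] [StarOrderedRing B]

/-- For a contraction `x` in a unital subalgebra `A`, the complement of the range projection of
`1 - x` is a peak projection for `A`, with peaking element `(1 + x) / 2`. -/
lemma exists_rangeProjection_isPeakProjection {A : Subalgebra ℂ B} {x : B} (hxA : x ∈ A)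
    (hx : ‖x‖ ≤ 1) :
    ∃ e : SecondDual B, IsPeakProjection A (compl e) ∧ mul e (canon (1 - x)) = canon (1 - x) ∧
      ∀ F : SecondDual B, mul F (canon (1 - x)) = 0 → mul F e = 0 := by
  let d : PUnit → B := fun _ => 1 - x
  obtain ⟨e, he, hlim, hunit, hzero, -⟩ := exists_rangeProjection d
  refine ⟨e, ⟨⟨he.compl, ?_⟩, (2⁻¹ : ℂ) • (1 + x), ?_, ?_, ?_, ?_⟩, hunit PUnit.unit,
    fun F hF => hzero F fun _ => hF⟩
  · rw [compl_compl]
    classical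
    exact ⟨he, Finset PUnit × ℕ, inferInstance, inferInstance, inferInstance, rangeNet d,
      rangeNet_mono d, rangeNet_mem d, hlim⟩
  · exact A.smul_mem (A.add_mem A.one_mem hxA) _
  · rw [norm_smul, norm_inv, Complex.norm_ofNat]
    have := (norm_add_le 1 x).trans (add_le_add norm_one_le_one hx)
    linarith
  · have hq : mul (compl e) (canon (1 - x)) = 0 := by
      rw [compl_mul, hunit PUnit.unit, sub_self]
    have ha : (2⁻¹ : ℂ) • (1 + x) = 1 - (2⁻¹ : ℂ) • (1 - x) := by module
    rw [ha, ← mulCanon_apply, map_sub, map_smul, mulCanon_apply, mulCanon_apply, hq, smul_zero,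
      mul_canon_one]
    exact secondDual_ext fun φ => sub_zero _
  · intro φ hφ hqφ
    by_contra! hcon
    obtain ⟨h1, h2⟩ := hφ.apply_one_sub_mul_star hx hcon
    have heφ : e φ = 0 := by
      refine tendsto_nhds_unique (((WeakDual.eval_continuous φ).tendsto e).comp hlim) ?_
      have : ∀ l, canon (rangeNet d l) φ = 0 := fun l => hφ.rangeNet_eq_zero (fun _ => h2) l
      simp only [Function.comp_def, this]
      exact tendsto_const_nhds
    have : φ 1 = 0 := by simpa [compl, heφ] using hqφ
    simp [this] at h1

/-- If `p` is the support projection of a subspace `J` of `A` with a left approximate identity of the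
form `1 - x_t`, then `1 - p` is the meet of the peak projections given by the `x_t`. -/
theorem isPProjection_compl_of_isLeftApproxIdentity {A : Subalgebra ℂ B} {J : Submodule ℂ B}
    {T : Type*} [Preorder T] [IsDirectedOrder T] [Nonempty T] {x : T → B}
    (hxA : ∀ t, x t ∈ A) (hx : ∀ t, ‖x t‖ ≤ 1) (he : IsLeftApproxIdentity J fun t => 1 - x t)
    {p : SecondDual B} (hp : IsSupportProjection A J p) : IsPProjection A (compl p) := by
  choose e hpeak hunit hzero using
    fun t => exists_rangeProjection_isPeakProjection (hxA t) (hx t)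
  refine ⟨Set.range fun t => compl (e t), ?_, hp.1.compl, ?_, ?_⟩
  · rintro _ ⟨t, rfl⟩
    exact hpeak t
  · rintro _ ⟨t, rfl⟩
    have hmem : canon (1 - x t) ∈ weakStarClosure (J : Set B) :=
      subset_closure ⟨_, he.1 t, rfl⟩
    rw [hp.2] at hmem
    obtain ⟨F, -, hF⟩ := hmem
    have hpd : mul p (canon (1 - x t)) = canon (1 - x t) := by
      rw [← hF, ← mul_assoc', hp.1.2]
    have h0 := hzero t (compl p) (by rw [compl_mul, hpd, sub_self])
    rw [ProjLE, mul_compl, h0]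
    exact secondDual_ext fun φ => sub_zero _
  · intro q hq hqr
    have hqd : ∀ t, mul q (canon (1 - x t)) = 0 := by
      intro t
      have h := hqr _ ⟨t, rfl⟩
      rw [ProjLE, mul_compl, sub_eq_self] at h
      rw [← hunit t, ← mul_assoc', h, zero_mul']
    obtain ⟨P, -, -, hPd, hP0, hPadj⟩ := exists_rangeProjection fun t => 1 - x t
    have hPj : ∀ j ∈ J, mul P (canon j) = canon j := by
      intro j hj
      refine secondDual_ext fun φ => ?_
      have h1 := ((continuous_mul_canon_apply P φ).tendsto j).comp (he.2 j hj)
      refine tendsto_nhds_unique h1 ?_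
      have h2 := (φ.continuous.tendsto j).comp (he.2 j hj)
      refine h2.congr fun t => ?_
      simp only [Function.comp_apply, mul_canon_mul, hPd]
      rfl
    have hpmem : p ∈ weakStarClosure (J : Set B) := by
      rw [hp.2]
      exact ⟨canon 1, subset_closure ⟨1, A.one_mem, rfl⟩, mul_canon_one p⟩
    have hPp : mul p P = p := by
      have hclosed : IsClosed {F : SecondDual B | mul (adj F) P = adj F} :=
        isClosed_eq ((continuous_mul_left P).comp continuous_adj) continuous_adj
      have hsub : canon '' (J : Set B) ⊆ {F : SecondDual B | mul (adj F) P = adj F} := by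
        rintro _ ⟨j, hj, rfl⟩
        rw [Set.mem_ofPred_eq, ← adj_adj (mul _ P), hPadj, adj_adj, hPj j hj]
      have h : mul (adj p) P = adj p := closure_minimal hsub hclosed hpmem
      rwa [hp.1.1] at h
    have hpP : mul P p = p := by
      have h := hPadj p
      rw [hPp, hp.1.1] at h
      exact h.symm
    rw [ProjLE, mul_compl, ← hpP, ← mul_assoc', hP0 q hqd, zero_mul']
    exact secondDual_ext fun φ => sub_zero _

end Main

end OperatorAlgebraPeak

end

theorem mainTheorem9 {B : Type*} [CStarAlgebra B] [PartialOrder B] [StarOrderedRing B]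
    (A : Subalgebra ℂ B) (J : Submodule ℂ B) (hJ : OperatorAlgebraPeak.IsRightIdeal A J)
    {T : Type*} [Preorder T] [IsDirectedOrder T] [Nonempty T] (x : T → B)
    (hxA : ∀ t, x t ∈ A) (hx : ∀ t, ‖x t‖ ≤ 1)
    (he : OperatorAlgebraPeak.IsLeftApproxIdentity J (fun t => 1 - x t))
    (p : OperatorAlgebraPeak.SecondDual B)
    (hp : OperatorAlgebraPeak.IsSupportProjection A J p) :
    OperatorAlgebraPeak.IsPProjection A (OperatorAlgebraPeak.compl p) :=
  OperatorAlgebraPeak.isPProjection_compl_of_isLeftApproxIdentity hxA hx he hp
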